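/- **Setting.** There are $N\ge 1$ agents $a_1,\dots,a_N$ and $K\ge 1$ arms $b_1,\dots,b_K$. Agent $a_i$ has utility $\mu_{i,j}$ for arm $b_j$ (without ties: $\mu_{i,j}\neq\mu_{i,k}$ for $j\ne k$), and every arm has a known strict total order over the agents. Let $\Delta=\min_i\min_{j\ne k}|\mu_{i,j}-\mu_{i,k}|$ (with $1/\Delta^2:=0$ if $K=1$). A matching is stable if no agent and arm both strictly prefer each other to their current situation, being matched always being preferred to being unmatched. Whenever $a_i$ pulls $b_j$ it observes a reward from a distribution with mean $\mu_{i,j}$ that is $1$-subgaussian, i.e. a variable $Y$ with this law satisfies $P(|Y-\mu_{i,j}|>t)\le 2e^{-t^2/2}$ for all $t\ge 0$; the rewards that an agent observes in different rounds are independent. **Algorithm.** Uniform sampling with parameter $\beta$ and a budget of $T\in\mathbb N\cup\{\infty\}$ rounds: in round $t=1,2,\dots$ every agent $a_i$ pulls the arm $b_j$, $j\in\{1,\dots,K\}$, with $j\equiv t+i-1 \pmod K$. If after a round $a_i$ has sampled $b_j$ in total $n\ge 1$ times, with sample average $\hat\mu_{i,j}$, put $$UCB_{i,j}=\hat\mu_{i,j}+\sqrt{2\beta\log(Kn)/n},\qquad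 LCB_{i,j}=\hat\mu_{i,j}-\sqrt{2\beta\log(Kn)/n},$$ and $UCB_{i,j}=+\infty$, $LCB_{i,j}=-\infty$ if $n=0$. The algorithm stops after the first round at whose end there is, for every agent $a_i$, a permutation $\sigma_i$ of the arms with $LCB_{i,\sigma_i(k)}>UCB_{i,\sigma_i(k+1)}$ for all $1\le k\le K-1$ (and after $T$ rounds at the latest). Then agent-proposing or arm-proposing Deferred Acceptance (DA) is run with the agents' preferences given by $\hat\mu$ and the arms' true preferences. **Theorem.** There are a universal constant $c>0$ and a function $S(N,K,\Delta,\alpha)\in\mathbb N$ with $$S(N,K,\Delta,\alpha)=\tilde O(g),\qquad g=NK\cdot\max\Bigl\{1,\frac1{\Delta^2}\Bigr\}\cdot\max\bigl\{1,\log(1/\alpha)\bigr\},$$ that is, $S\le C\,g\,\log^p(2+g)$ with universal constants $C>0$ and $p\in\mathbb N$, such that the following holds for every market as above and every $\alpha\in(0,1)$. Run uniform sampling with $\beta=c\,\bigl(1+\log(4N/\alpha)/\log K\bigr)$ (the quotient is read as $0$ if $K=1$) and any budget $T$ with $NT\ge S(N,K,\Delta,\alpha)$. Then, with probability at least $1-\alpha$,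 the algorithm stops by its stopping rule, the total number of samples over all agent-arm pairs is at most $S(N,K,\Delta,\alpha)$, and both the matching computed by agent-proposing DA and the one computed by arm-proposing DA are stable with respect to the true preferences (and match every agent if $N\le K$). -/

import Mathlib

open MeasureTheory ProbabilityTheory

noncomputable section

/-! ## Two-sided markets: matchings, blocking pairs, stability

Agents are `Fin N`, arms are `Fin K` (numbered from `0`).  Utilities of agents are reals `μ i j`;
`armPref j a a'` says that arm `j` strictly prefers agent `a` to agent `a'`. -/

/-- A (one-to-one, possibly partial) matching; `none` stands for "unmatched". -/
structure Matching (N K : ℕ) where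
  agent : Fin N → Option (Fin K)
  arm : Fin K → Option (Fin N)
  consistent : ∀ i j, agent i = some j ↔ arm j = some i

/-- The agent with utilities `u` prefers arm `j` to the partner `o`; being matched is better than
being unmatched. -/
def AgentPrefers {K : ℕ} (u : Fin K → ℝ) (j : Fin K) : Option (Fin K) → Prop
  | none => True
  | some j' => u j' < u j

/-- The arm with preference relation `r` prefers agent `i` to the partner `o`; being matched is
better than being unmatched. -/
def ArmPrefers {N : ℕ} (r : Fin N → Fin N → Prop) (i : Fin N) : Option (Fin N) → Prop
  | none => True
  | some i' => r i i'

def IsBlockingPair {N K : ℕ} (μ : Fin N → Fin K → ℝ) (armPref : Fin K → Fin N → Fin N → Prop)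
    (m : Matching N K) (i : Fin N) (j : Fin K) : Prop :=
  AgentPrefers (μ i) j (m.agent i) ∧ ArmPrefers (armPref j) i (m.arm j)

def IsStableMatching {N K : ℕ} (μ : Fin N → Fin K → ℝ) (armPref : Fin K → Fin N → Fin N → Prop)
    (m : Matching N K) : Prop :=
  ∀ i j, ¬ IsBlockingPair μ armPref m i j

/-- Minimum preference gap `Δ = min_i min_{j ≠ k} |μ i j - μ i k|`.  The index type is finite, so
this is a minimum unless it is empty, in which case (`K = 1`) the value is `0`. -/
def minGap {N K : ℕ} (μ : Fin N → Fin K → ℝ) : ℝ :=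
  ⨅ p : {p : Fin N × Fin K × Fin K // p.2.1 ≠ p.2.2}, |μ p.1.1 p.1.2.1 - μ p.1.1 p.1.2.2|

/-! ## The Deferred Acceptance algorithm

Proposers `A`, receivers `B`; `prefA a b b'` says that `a` strictly prefers `b` to `b'`, and
`prefB b a a'` that `b` strictly prefers `a` to `a'`.  The state is the set `rej a` of receivers
that have rejected `a` so far. -/

section DA

variable {A B : Type*}

open Classical in
/-- The most preferred element of `s`, if there is one. -/
def best (r : A → A → Prop) (s : Finset A) : Option A :=
  if h : ∃ x ∈ s, ∀ y ∈ s, y ≠ x → r x y then some h.choose else none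

theorem mem_of_best {r : A → A → Prop} {s : Finset A} {x : A} (h : best r s = some x) : x ∈ s := by
  unfold best at h
  split_ifs at h with h'
  cases h
  exact h'.choose_spec.1

variable [Fintype A] [Fintype B] [DecidableEq A] [DecidableEq B]

/-- Every proposer proposes to its favourite receiver among those that have not rejected it. -/
def proposal (prefA : A → B → B → Prop) (rej : A → Finset B) (a : A) : Option B :=
  best (prefA a) (rej a)ᶜ

/-- Every receiver tentatively holds the most preferred proposal that it gets. -/
def held (prefA : A → B → B → Prop) (prefB : B → A → A → Prop) (rej : A → Finset B) (b : B) :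
    Option A :=
  best (prefB b) {a | proposal prefA rej a = some b}

/-- One round of proposals: every proposal that is not held is rejected. -/
def daStep (prefA : A → B → B → Prop) (prefB : B → A → A → Prop) (rej : A → Finset B) :
    A → Finset B :=
  fun a => rej a ∪
    ({b | proposal prefA rej a = some b ∧ held prefA prefB rej b ≠ some a} : Finset B)

/-- The state in which the process has come to rest; see `daStep_daFinal`. -/
def daFinal (prefA : A → B → B → Prop) (prefB : B → A → A → Prop) : A → Finset B :=
  (daStep prefA prefB)^[Fintype.card A * Fintype.card B] (fun _ => ∅)

/-- In the final state no further rejection takes place. -/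
theorem daStep_daFinal (prefA : A → B → B → Prop) (prefB : B → A → A → Prop) :
    daStep prefA prefB (daFinal prefA prefB) = daFinal prefA prefB := by
  set f := daStep prefA prefB with hf
  have hsub : ∀ rej a, rej a ⊆ f rej a := fun rej a => Finset.subset_union_left
  have key : ∀ n : ℕ, f (f^[n] fun _ => ∅) = f^[n] (fun _ => ∅) ∨
      n ≤ ∑ a, ((f^[n] fun _ => ∅) a).card := by
    intro n
    induction n with
    | zero => right; simp
    | succ n ih =>
      rw [Function.iterate_succ_apply']
      rcases ih with h | h
      · left; rw [h, h]
      · by_cases he : f (f^[n] fun _ => ∅) = f^[n] (fun _ => ∅)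
        · left; rw [he, he]
        · right
          obtain ⟨a, ha⟩ := Function.ne_iff.1 he
          have hlt : ∑ a, ((f^[n] fun _ => ∅) a).card < ∑ a, (f (f^[n] fun _ => ∅) a).card :=
            Finset.sum_lt_sum (fun a _ => Finset.card_le_card (hsub _ a))
              ⟨a, Finset.mem_univ a,
                Finset.card_lt_card ((hsub _ a).ssubset_of_ne (Ne.symm ha))⟩
          omega
  rcases key (Fintype.card A * Fintype.card B) with h | h
  · exact h
  · have hle : ∀ a, (daFinal prefA prefB a).card ≤ Fintype.card B := fun a => Finset.card_le_univ _
    have hsum : ∑ a, (daFinal prefA prefB a).card = ∑ _a : A, Fintype.card B := by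
      apply le_antisymm (Finset.sum_le_sum fun a _ => hle a)
      simpa [daFinal] using h
    have heq := (Finset.sum_eq_sum_iff_of_le fun a _ => hle a).1 hsum
    funext a
    have hu : daFinal prefA prefB a = Finset.univ :=
      (Finset.card_eq_iff_eq_univ _).1 (heq a (Finset.mem_univ a))
    apply Finset.Subset.antisymm
    · rw [hu]; exact Finset.subset_univ _
    · exact hsub _ a

/-- Receiver's partner at the end: the proposer that it holds. -/
def daReceiver (prefA : A → B → B → Prop) (prefB : B → A → A → Prop) (b : B) : Option A :=
  held prefA prefB (daFinal prefA prefB) b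

/-- Proposer's partner at the end: the receiver that holds its proposal. -/
def daProposer (prefA : A → B → B → Prop) (prefB : B → A → A → Prop) (a : A) : Option B :=
  (proposal prefA (daFinal prefA prefB) a).filter
    fun b => decide (daReceiver prefA prefB b = some a)

theorem daProposer_eq_some_iff (prefA : A → B → B → Prop) (prefB : B → A → A → Prop)
    (a : A) (b : B) :
    daProposer prefA prefB a = some b ↔ daReceiver prefA prefB b = some a := by
  unfold daProposer
  rw [Option.filter_eq_some_iff]
  simp only [decide_eq_true_eq]
  refine ⟨fun h => h.2, fun h => ⟨?_, h⟩⟩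
  have := mem_of_best h
  simpa using this

end DA

/-- Preference of an agent with (estimated) utilities `u`: larger utility first.  Ties, which leave
the preference undetermined, are broken by the index, so that this is a strict total order. -/
def prefOf {K : ℕ} (u : Fin K → ℝ) (j k : Fin K) : Prop :=
  u k < u j ∨ (u j = u k ∧ j < k)

/-- Agent-proposing DA. -/
def agentDA {N K : ℕ} (u : Fin N → Fin K → ℝ) (armPref : Fin K → Fin N → Fin N → Prop) :
    Matching N K where
  agent := daProposer (fun i => prefOf (u i)) armPref
  arm := daReceiver (fun i => prefOf (u i)) armPref
  consistent i j := daProposer_eq_some_iff _ _ i j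

/-- Arm-proposing DA. -/
def armDA {N K : ℕ} (u : Fin N → Fin K → ℝ) (armPref : Fin K → Fin N → Fin N → Prop) :
    Matching N K where
  agent := daReceiver armPref (fun i => prefOf (u i))
  arm := daProposer armPref (fun i => prefOf (u i))
  consistent i j := (daProposer_eq_some_iff _ _ j i).symm

/-! ## Uniform sampling with confidence intervals

Rounds are `s = 0, 1, 2, …`; "after `t` rounds" refers to the rounds `s < t`.
`x i s` is the reward that agent `i` observes in round `s`. -/

/-- Round-robin schedule: the arm that agent `i` pulls in round `s`. -/
def pulledArm (N K : ℕ) [NeZero K] (i : Fin N) (s : ℕ) : Fin K :=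
  Fin.ofNat K (s + i)

/-- The rounds among the first `t` in which agent `i` pulls arm `j`. -/
def pullRounds {N K : ℕ} [NeZero K] (i : Fin N) (j : Fin K) (t : ℕ) : Finset ℕ :=
  {s ∈ Finset.range t | pulledArm N K i s = j}

/-- Total number of samples, over all agent-arm pairs, after `t` rounds. -/
def totalSamples (N K : ℕ) [NeZero K] (t : ℕ) : ℕ :=
  ∑ i : Fin N, ∑ j : Fin K, (pullRounds i j t).card

/-- Sample average of agent `i` over arm `j` after `t` rounds. -/
def sampleMean {N K : ℕ} [NeZero K] (x : Fin N → ℕ → ℝ) (t : ℕ) (i : Fin N) (j : Fin K) : ℝ :=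
  (∑ s ∈ pullRounds i j t, x i s) / (pullRounds i j t).card

/-- Half-width of the confidence interval after `n ≥ 1` samples of a pair. -/
def confRadius (K : ℕ) (β : ℝ) (n : ℕ) : ℝ :=
  Real.sqrt (2 * β * Real.log (K * n) / n)

/-- Upper confidence bound; `+∞` for a pair that has not been sampled. -/
def ucb {N K : ℕ} [NeZero K] (β : ℝ) (x : Fin N → ℕ → ℝ) (t : ℕ) (i : Fin N) (j : Fin K) : EReal :=
  if (pullRounds i j t).card = 0 then ⊤
  else ((sampleMean x t i j + confRadius K β (pullRounds i j t).card : ℝ) : EReal)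

/-- Lower confidence bound; `-∞` for a pair that has not been sampled. -/
def lcb {N K : ℕ} [NeZero K] (β : ℝ) (x : Fin N → ℕ → ℝ) (t : ℕ) (i : Fin N) (j : Fin K) : EReal :=
  if (pullRounds i j t).card = 0 then ⊥
  else ((sampleMean x t i j - confRadius K β (pullRounds i j t).card : ℝ) : EReal)

/-- The stopping test after `t` rounds: for every agent some ordering of the arms separates the
confidence intervals. -/
def StopTest {N K : ℕ} [NeZero K] (β : ℝ) (x : Fin N → ℕ → ℝ) (t : ℕ) : Prop :=
  ∀ i : Fin N, ∃ σ : Equiv.Perm (Fin K), ∀ (k : ℕ) (hk : k + 1 < K),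
    ucb β x t i (σ ⟨k + 1, hk⟩) < lcb β x t i (σ ⟨k, Nat.lt_of_succ_lt hk⟩)

/-- Number of rounds played by the uniform sampling algorithm with parameter `β` and a budget of
`T` rounds (`T = ⊤`: no budget): it stops after the first round `t ≥ 1` at the end of which the
stopping test succeeds, and after `T` rounds at the latest. -/
def roundsPlayed {N K : ℕ} [NeZero K] (β : ℝ) (T : ℕ∞) (x : Fin N → ℕ → ℝ) : ℕ∞ :=
  min T (sInf {r : ℕ∞ | ∃ t : ℕ, 1 ≤ t ∧ StopTest (K := K) β x t ∧ r = t})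

/-- The parameter `β` of the confidence intervals: `β = c (1 + log (4N/α) / log K)`. -/
def betaParam (c : ℝ) (N K : ℕ) (α : ℝ) : ℝ :=
  c * (1 + Real.log (4 * N / α) / Real.log K)

/-! ## Rewards and rates -/

/-- `X` is `d`-subgaussian: `P(|X| > t) ≤ 2 exp(-t²/(2d²))` for all `t ≥ 0`. -/
def IsSubgaussian {Ω : Type*} [MeasurableSpace Ω] (d : ℝ) (X : Ω → ℝ) (P : Measure Ω) : Prop :=
  ∀ t : ℝ, 0 ≤ t → P.real {ω | t < |X ω|} ≤ 2 * Real.exp (-(t ^ 2) / (2 * d ^ 2))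

/-- A `1`-subgaussian reward distribution on `ℝ` with mean `m`. -/
def IsRewardLaw (ν : Measure ℝ) (m : ℝ) : Prop :=
  IsProbabilityMeasure ν ∧ Integrable (fun x => x) ν ∧ ∫ x, x ∂ν = m ∧
    IsSubgaussian 1 (fun x => x - m) ν

/-- `f = Õ(g)`, uniformly over the parameters: `f ≤ C · g · (log (2 + g)) ^ p` for constants
`C`, `p` that do not depend on the parameters. -/
def IsSoftO {ι : Type*} (f g : ι → ℝ) : Prop :=
  ∃ C : ℝ, 0 < C ∧ ∃ p : ℕ, ∀ x, f x ≤ C * g x * Real.log (2 + g x) ^ p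

end

noncomputable section

/-! ## From subgaussian tails to subgaussian moment generating functions -/

/-! The argument is a union bound over confidence intervals, followed by a deterministic analysis on
the event that all of them are valid.

Probability. A centred variable with tail `2 exp(-t²/2)` has a subgaussian moment generating
function with variance proxy 16 (`IsSubgaussian.hasSubgaussianMGF`). Hoeffding then bounds the
chance that an average of `n` rewards errs by more than `r` by `2 exp(-n r²/32)`. With `c = 32` and
`r` the confidence radius this is at most `α / (2 N K² n²)`, which is summable over `n` and over the
`N K` pairs to at most `α` (`measure_not_confidenceValid_le`). Rounds need no union bound of their
own: the sample set of a pair depends only on its size.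

Correctness. Separated valid intervals order estimates and true means alike, so whenever the test
succeeds DA runs on the true preferences (`StopTest.sampleMean_lt`). Its outcome is stable because a
receiver only ever trades up (`RejectedForBetter`, `da_stable`).

Termination. After `K n` rounds each pair has exactly `n` samples, and the test succeeds once four
radii are below `Δ` (`stopTest_mul`). The radius squared is of order `β log(K n) / n`, so `n` of
order `max(1, 1/Δ²) max(1, log(1/α))` times a squared logarithm is enough. -/

theorem exp_le_add_exp_sq (x : ℝ) : Real.exp x ≤ x + Real.exp (x ^ 2) := by
  have h1 := Real.add_one_le_exp (x ^ 2)
  rcases le_or_gt |x| 1 with h | h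
  · have := (abs_le.1 (Real.abs_exp_sub_one_sub_id_le h)).2
    linarith
  · rcases lt_abs.1 h with h | h
    · have : Real.exp x ≤ Real.exp (x ^ 2) := Real.exp_le_exp.2 (by nlinarith)
      linarith
    · have : Real.exp x ≤ 1 := Real.exp_le_one_iff.2 (by linarith)
      nlinarith

/-- The integrand is the tail bound `2 exp(-t²/2)` times `t/4 * exp(t²/8)`, the derivative of
`exp(t²/8)`, as needed for the layer-cake formula. -/
theorem lintegral_Ioi_mul_exp_neg_mul_sq :
    ∫⁻ t in Set.Ioi (0 : ℝ), ENNReal.ofReal (t / 2 * Real.exp (-(3 / 8) * t ^ 2)) =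
      ENNReal.ofReal (2 / 3) := by
  have hd : ∀ x ∈ Set.Ici (0 : ℝ), HasDerivAt (fun t : ℝ => -(2 / 3) * Real.exp (-(3 / 8) * t ^ 2))
      (x / 2 * Real.exp (-(3 / 8) * x ^ 2)) x := by
    intro x _
    have := ((((hasDerivAt_id x).pow 2).const_mul (-(3 / 8) : ℝ)).exp).const_mul (-(2 / 3) : ℝ)
    refine this.congr_deriv ?_
    simp
    ring
  have hnn : ∀ x ∈ Set.Ioi (0 : ℝ), 0 ≤ x / 2 * Real.exp (-(3 / 8) * x ^ 2) := by
    intro x hx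
    have : (0 : ℝ) < x := hx
    positivity
  have ht : Filter.Tendsto (fun t : ℝ => -(2 / 3) * Real.exp (-(3 / 8) * t ^ 2)) Filter.atTop
      (nhds (-(2 / 3) * 0)) := by
    refine Filter.Tendsto.const_mul _ (Real.tendsto_exp_atBot.comp ?_)
    exact (Filter.tendsto_pow_atTop two_ne_zero).const_mul_atTop_of_neg (by norm_num)
  have hi := integrableOn_Ioi_deriv_of_nonneg' hd hnn ht
  rw [← ofReal_integral_eq_lintegral_ofReal hi
    ((ae_restrict_iff' measurableSet_Ioi).2 (Filter.Eventually.of_forall hnn)),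
    integral_Ioi_of_hasDerivAt_of_nonneg' hd hnn ht]
  norm_num

section

variable {Ω : Type*} [MeasurableSpace Ω] {P : Measure Ω} [IsProbabilityMeasure P] {Y : Ω → ℝ}

theorem IsSubgaussian.lintegral_exp_sq_sub_one_le (hY : AEMeasurable Y P)
    (h : IsSubgaussian 1 Y P) :
    ∫⁻ ω, ENNReal.ofReal (Real.exp (Y ω ^ 2 / 8) - 1) ∂P ≤ ENNReal.ofReal (2 / 3) := by
  have hint : ∀ y : ℝ, ∫ t in (0 : ℝ)..y, t / 4 * Real.exp (t ^ 2 / 8) =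
      Real.exp (y ^ 2 / 8) - 1 := by
    intro y
    have hd : ∀ x ∈ Set.uIcc (0 : ℝ) y, HasDerivAt (fun t : ℝ => Real.exp (t ^ 2 / 8))
        (x / 4 * Real.exp (x ^ 2 / 8)) x := by
      intro x _
      have := (((hasDerivAt_id x).pow 2).div_const (8 : ℝ)).exp
      refine this.congr_deriv ?_
      simp
      ring
    rw [intervalIntegral.integral_eq_sub_of_hasDerivAt hd
      (Continuous.intervalIntegrable (by fun_prop) _ _)]
    simp
  have hlc := lintegral_comp_eq_lintegral_meas_lt_mul P (f := fun ω => |Y ω|)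
    (g := fun t => t / 4 * Real.exp (t ^ 2 / 8)) (Filter.Eventually.of_forall fun _ => abs_nonneg _)
    hY.abs (fun t _ => Continuous.intervalIntegrable (by fun_prop) _ _)
    ((ae_restrict_iff' measurableSet_Ioi).2 (Filter.Eventually.of_forall fun t ht => by
      have : (0 : ℝ) < t := ht
      positivity))
  simp only [hint, sq_abs] at hlc
  rw [hlc, ← lintegral_Ioi_mul_exp_neg_mul_sq]
  refine setLIntegral_mono' measurableSet_Ioi fun t ht => ?_
  have ht : (0 : ℝ) < t := ht
  have h1 : P {ω | t < |Y ω|} ≤ ENNReal.ofReal (2 * Real.exp (-(t ^ 2) / (2 * 1 ^ 2))) := by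
    rw [← ofReal_measureReal]
    exact ENNReal.ofReal_le_ofReal (h t ht.le)
  calc _ ≤ ENNReal.ofReal (2 * Real.exp (-(t ^ 2) / (2 * 1 ^ 2))) *
        ENNReal.ofReal (t / 4 * Real.exp (t ^ 2 / 8)) := by gcongr
    _ = _ := by
      rw [← ENNReal.ofReal_mul (by positivity)]
      congr 1
      rw [show -(3 / 8) * t ^ 2 = -(t ^ 2) / (2 * 1 ^ 2) + t ^ 2 / 8 by ring, Real.exp_add]
      ring

theorem IsSubgaussian.integrable_exp_sq (hY : AEMeasurable Y P) (h : IsSubgaussian 1 Y P) :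
    Integrable (fun ω => Real.exp (Y ω ^ 2 / 8)) P := by
  have : Integrable (fun ω => Real.exp (Y ω ^ 2 / 8) - 1) P := by
    refine ⟨(by fun_prop : AEMeasurable _ P).aestronglyMeasurable, ?_⟩
    rw [hasFiniteIntegral_iff_ofReal (Filter.Eventually.of_forall fun ω => ?_)]
    · exact (h.lintegral_exp_sq_sub_one_le hY).trans_lt ENNReal.ofReal_lt_top
    · simp only [Pi.zero_apply, sub_nonneg, Real.one_le_exp_iff]
      positivity
  refine (this.add (integrable_const (1 : ℝ))).congr (Filter.Eventually.of_forall fun ω => ?_)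
  simp

theorem IsSubgaussian.integral_exp_sq_le (hY : AEMeasurable Y P) (h : IsSubgaussian 1 Y P) :
    ∫ ω, Real.exp (Y ω ^ 2 / 8) ∂P ≤ 5 / 3 := by
  have h1 : ∫ ω, (Real.exp (Y ω ^ 2 / 8) - 1) ∂P ≤ 2 / 3 := by
    rw [integral_eq_lintegral_of_nonneg_ae]
    · exact ENNReal.toReal_le_of_le_ofReal (by norm_num) (h.lintegral_exp_sq_sub_one_le hY)
    · refine Filter.Eventually.of_forall fun ω => ?_
      simp only [Pi.zero_apply, sub_nonneg, Real.one_le_exp_iff]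
      positivity
    · exact (by fun_prop : AEMeasurable _ P).aestronglyMeasurable
  rw [integral_sub (h.integrable_exp_sq hY) (integrable_const _)] at h1
  simp only [integral_const, probReal_univ, smul_eq_mul, mul_one] at h1
  linarith

theorem mul_le_two_mul_sq_add (l y : ℝ) : l * y ≤ 2 * l ^ 2 + y ^ 2 / 8 := by
  nlinarith [sq_nonneg (y - 4 * l)]

/-- A centred variable with subgaussian tails has a subgaussian moment generating function. -/
theorem IsSubgaussian.hasSubgaussianMGF (hi : Integrable Y P) (h0 : ∫ ω, Y ω ∂P = 0)
    (h : IsSubgaussian 1 Y P) : HasSubgaussianMGF Y 16 P := by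
  have hY := hi.aemeasurable
  have hI := h.integrable_exp_sq hY
  have hle := h.integral_exp_sq_le hY
  have hexp : ∀ t, Integrable (fun ω => Real.exp (t * Y ω)) P := by
    intro t
    refine (hI.const_mul (Real.exp (2 * t ^ 2))).mono'
      (by fun_prop : AEMeasurable _ P).aestronglyMeasurable (Filter.Eventually.of_forall fun ω => ?_)
    rw [Real.norm_eq_abs, Real.abs_exp, ← Real.exp_add]
    exact Real.exp_le_exp.2 (mul_le_two_mul_sq_add _ _)
  refine ⟨hexp, fun t => ?_⟩
  have hgoal : ((16 : NNReal) : ℝ) * t ^ 2 / 2 = 8 * t ^ 2 := by push_cast; ring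
  rw [hgoal, mgf]
  -- For small `t` the linear term must vanish by centring, and convexity interpolates `exp(t²Y²)`
  -- between `1` and `exp(Y²/8)`. For large `t` a crude AM-GM bound is enough, since `6 t² > 3/4`
  -- absorbs the factor `5/3`.
  rcases le_or_gt (t ^ 2) (1 / 8) with ht | ht
  · have hpt : ∀ ω, Real.exp (t * Y ω) ≤
        t * Y ω + ((1 - 8 * t ^ 2) + 8 * t ^ 2 * Real.exp (Y ω ^ 2 / 8)) := by
      intro ω
      refine (exp_le_add_exp_sq _).trans (add_le_add_right ?_ _)
      have := convexOn_exp.2 (Set.mem_univ (0 : ℝ)) (Set.mem_univ (Y ω ^ 2 / 8))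
        (by linarith : 0 ≤ 1 - 8 * t ^ 2) (by positivity : 0 ≤ 8 * t ^ 2) (by ring)
      simp only [smul_eq_mul, mul_zero, zero_add, Real.exp_zero, mul_one] at this
      refine le_trans (le_of_eq ?_) this
      congr 1
      ring
    have i1 : Integrable (fun ω => t * Y ω) P := hi.const_mul t
    have i2 : Integrable (fun ω => 8 * t ^ 2 * Real.exp (Y ω ^ 2 / 8)) P := hI.const_mul _
    have i3 : Integrable (fun ω => (1 - 8 * t ^ 2) + 8 * t ^ 2 * Real.exp (Y ω ^ 2 / 8)) P :=
      (integrable_const _).add i2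
    calc ∫ ω, Real.exp (t * Y ω) ∂P
        ≤ ∫ ω, (t * Y ω + ((1 - 8 * t ^ 2) + 8 * t ^ 2 * Real.exp (Y ω ^ 2 / 8))) ∂P :=
          integral_mono (hexp t) (i1.add i3) hpt
      _ = (1 - 8 * t ^ 2) + 8 * t ^ 2 * ∫ ω, Real.exp (Y ω ^ 2 / 8) ∂P := by
          rw [integral_add i1 i3, integral_add (integrable_const _) i2,
            integral_const_mul, integral_const_mul, h0]
          simp
      _ ≤ 8 * t ^ 2 + 1 := by nlinarith [sq_nonneg t]
      _ ≤ _ := Real.add_one_le_exp _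
  · calc ∫ ω, Real.exp (t * Y ω) ∂P
        ≤ ∫ ω, Real.exp (2 * t ^ 2) * Real.exp (Y ω ^ 2 / 8) ∂P := by
          refine integral_mono (hexp t) (hI.const_mul _) fun ω => ?_
          simp only [← Real.exp_add]
          exact Real.exp_le_exp.2 (mul_le_two_mul_sq_add _ _)
      _ = Real.exp (2 * t ^ 2) * ∫ ω, Real.exp (Y ω ^ 2 / 8) ∂P := integral_const_mul _ _
      _ ≤ Real.exp (2 * t ^ 2) * Real.exp (6 * t ^ 2) := by
          gcongr
          linarith [Real.add_one_le_exp (6 * t ^ 2)]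
      _ = _ := by rw [← Real.exp_add]; ring_nf

end

theorem IsRewardLaw.hasSubgaussianMGF {ν : Measure ℝ} {m : ℝ} (h : IsRewardLaw ν m) :
    HasSubgaussianMGF (fun x => x - m) 16 ν := by
  obtain ⟨h1, h2, h3, h4⟩ := h
  refine h4.hasSubgaussianMGF (h2.sub (integrable_const _)) ?_
  rw [integral_sub h2 (integrable_const _), h3]
  simp

/-- Hoeffding's bound, two-sided, for sums of independent rewards. -/
theorem measureReal_lt_abs_sum_le {Ω : Type*} [MeasurableSpace Ω] {P : Measure Ω}
    [IsProbabilityMeasure P] {X : ℕ → Ω → ℝ} {ν : ℕ → Measure ℝ} {m : ℕ → ℝ}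
    (hν : ∀ s, IsRewardLaw (ν s) (m s)) (hX : ∀ s, HasLaw (X s) (ν s) P) (hind : iIndepFun X P)
    (F : Finset ℕ) {ε : ℝ} (hε : 0 ≤ ε) :
    P.real {ω | ε < |∑ s ∈ F, (X s ω - m s)|} ≤ 2 * Real.exp (-ε ^ 2 / (32 * F.card)) := by
  have hsg : ∀ s ∈ F, HasSubgaussianMGF (fun ω => X s ω - m s) 16 P := fun s _ =>
    HasSubgaussianMGF.of_map (Y := X s) (X := fun x => x - m s) (hX s).aemeasurable
      (by rw [(hX s).map_eq]; exact (hν s).hasSubgaussianMGF)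
  have hi : iIndepFun (fun s ω => X s ω - m s) P :=
    hind.comp (fun s x => x - m s) fun s => by fun_prop
  have hi' : iIndepFun (fun s ω => -(X s ω - m s)) P :=
    hind.comp (fun s x => -(x - m s)) fun s => by fun_prop
  have h1 := HasSubgaussianMGF.measure_sum_ge_le_of_iIndepFun hi hsg hε
  have h2 := HasSubgaussianMGF.measure_sum_ge_le_of_iIndepFun hi'
    (fun s hs => (hsg s hs).neg) hε
  have hsub : {ω | ε < |∑ s ∈ F, (X s ω - m s)|} ⊆
      {ω | ε ≤ ∑ s ∈ F, (X s ω - m s)} ∪ {ω | ε ≤ ∑ s ∈ F, -(X s ω - m s)} := by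
    intro ω hω
    rcases lt_abs.1 (Set.mem_ofPred_eq ▸ hω : ε < _) with h | h
    · exact Or.inl h.le
    · refine Or.inr ?_
      simp only [Set.mem_ofPred_eq, Finset.sum_neg_distrib]
      exact h.le
  have hc : (2 : ℝ) * ((∑ _s ∈ F, (16 : NNReal) : NNReal) : ℝ) = 32 * F.card := by
    simp
    ring
  rw [hc] at h1 h2
  calc _ ≤ _ := measureReal_mono hsub
    _ ≤ _ := measureReal_union_le _ _
    _ ≤ _ := by linarith

/-! ## Deferred Acceptance computes stable matchings -/

section

variable {A B : Type*}

theorem best_spec {r : A → A → Prop} {s : Finset A} {x : A} (h : best r s = some x) :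
    ∀ y ∈ s, y ≠ x → r x y := by
  unfold best at h
  split_ifs at h with h'
  cases h
  exact h'.choose_spec.2

theorem exists_best_eq_some {r : A → A → Prop} [IsStrictTotalOrder A r] {s : Finset A}
    (hs : s.Nonempty) : ∃ x, best r s = some x := by
  have : ∃ x ∈ s, ∀ y ∈ s, y ≠ x → r x y := by
    induction hs using Finset.Nonempty.cons_induction with
    | singleton a => exact ⟨a, by simp, by simp⟩
    | cons a s ha hs ih =>
      obtain ⟨x, hx, hxs⟩ := ih
      have hax : a ≠ x := fun h => ha (h ▸ hx)
      rcases trichotomous_of r a x with h | h | h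
      · refine ⟨a, by simp, fun y hy hya => ?_⟩
        rcases Finset.mem_cons.1 hy with rfl | hy
        · exact absurd rfl hya
        · by_cases hyx : y = x
          · exact hyx ▸ h
          · exact trans_of r h (hxs y hy hyx)
      · exact absurd h hax
      · refine ⟨x, Finset.mem_cons_of_mem hx, fun y hy hyx => ?_⟩
        rcases Finset.mem_cons.1 hy with rfl | hy
        · exact h
        · exact hxs y hy hyx
  unfold best
  rw [dif_pos this]
  exact ⟨_, rfl⟩

variable [Fintype A] [Fintype B] [DecidableEq A] [DecidableEq B]
  {prefA : A → B → B → Prop} {prefB : B → A → A → Prop}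

theorem proposal_of_held {rej : A → Finset B} {a : A} {b : B}
    (h : held prefA prefB rej b = some a) : proposal prefA rej a = some b := by
  simpa using mem_of_best h

/-- Every rejected proposer was rejected in favour of one that the receiver likes better than it
and holds. -/
def RejectedForBetter (prefA : A → B → B → Prop) (prefB : B → A → A → Prop)
    (rej : A → Finset B) : Prop :=
  ∀ a b, b ∈ rej a → ∃ a', held prefA prefB rej b = some a' ∧ prefB b a' a

/-- A held proposer is not rejected in this round, so its set of rejections, and with it its
proposal, stays the same. -/
theorem proposal_daStep_of_held {rej : A → Finset B} {a : A} {b : B}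
    (h : held prefA prefB rej b = some a) :
    proposal prefA (daStep prefA prefB rej) a = some b := by
  have hp := proposal_of_held h
  have : daStep prefA prefB rej a = rej a := by
    unfold daStep
    rw [Finset.union_eq_left]
    intro b' hb'
    simp only [Finset.mem_filter, Finset.mem_univ, true_and, hp, Option.some.injEq] at hb'
    obtain ⟨rfl, h'⟩ := hb'
    exact absurd h h'
  unfold proposal at hp ⊢
  rwa [this]

/-- The proposer held now proposes again to the same receiver, so the next one held is at least as
good; transitivity carries the comparison along. -/
theorem RejectedForBetter.daStep [∀ b, IsStrictTotalOrder A (prefB b)] {rej : A → Finset B}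
    (h : RejectedForBetter prefA prefB rej) :
    RejectedForBetter prefA prefB (daStep prefA prefB rej) := by
  intro a b hb
  have h1 : ∃ a', held prefA prefB rej b = some a' ∧ prefB b a' a := by
    rcases Finset.mem_union.1 hb with hb | hb
    · exact h a b hb
    · simp only [Finset.mem_filter, Finset.mem_univ, true_and] at hb
      have hmem : a ∈ ({a | proposal prefA rej a = some b} : Finset A) := by simpa using hb.1
      obtain ⟨a', ha'⟩ := exists_best_eq_some (r := prefB b) ⟨a, hmem⟩
      refine ⟨a', ha', best_spec ha' a hmem ?_⟩
      rintro rfl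
      exact hb.2 ha'
  obtain ⟨a', ha', hpr⟩ := h1
  have hmem : a' ∈ ({a | proposal prefA (_root_.daStep prefA prefB rej) a = some b} : Finset A) := by
    simpa using proposal_daStep_of_held ha'
  obtain ⟨a'', ha''⟩ := exists_best_eq_some (r := prefB b) ⟨a', hmem⟩
  refine ⟨a'', ha'', ?_⟩
  by_cases he : a' = a''
  · exact he ▸ hpr
  · exact trans_of (prefB b) (best_spec ha'' a' hmem he) hpr

theorem rejectedForBetter_daFinal [∀ b, IsStrictTotalOrder A (prefB b)] :
    RejectedForBetter prefA prefB (daFinal prefA prefB) := by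
  unfold daFinal
  generalize Fintype.card A * Fintype.card B = n
  induction n with
  | zero => intro a b hb; simp at hb
  | succ n ih => rw [Function.iterate_succ_apply']; exact ih.daStep

/-- In the outcome of Deferred Acceptance there is no blocking pair. -/
theorem da_stable [∀ a, IsStrictTotalOrder B (prefA a)] [∀ b, IsStrictTotalOrder A (prefB b)]
    (a : A) (b : B) (ha : ∀ b', daProposer prefA prefB a = some b' → prefA a b b')
    (hb : ∀ a', daReceiver prefA prefB b = some a' → prefB b a a') : False := by
  set rej := daFinal prefA prefB with hrej
  by_cases hbr : b ∈ rej a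
  · obtain ⟨a', h1, h2⟩ := rejectedForBetter_daFinal a b hbr
    exact asymm_of (prefB b) h2 (hb a' h1)
  · have hmem : b ∈ (rej a)ᶜ := by simpa using hbr
    obtain ⟨b', hb'⟩ := exists_best_eq_some (r := prefA a) ⟨b, hmem⟩
    -- An unheld proposal would cause a further rejection, but the final state is a fixed point. So
    -- the best receiver that has not rejected `a` is its partner, and it is at least as good as
    -- `b`.
    have hheld : held prefA prefB rej b' = some a := by
      by_contra hne
      have : b' ∈ daStep prefA prefB rej a := by
        unfold daStep
        refine Finset.mem_union_right _ ?_
        simp only [Finset.mem_filter, Finset.mem_univ, true_and]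
        exact ⟨hb', hne⟩
      rw [hrej, daStep_daFinal, ← hrej] at this
      exact absurd (mem_of_best hb') (by simpa using this)
    have h1 := ha b' ((daProposer_eq_some_iff _ _ _ _).2 hheld)
    by_cases he : b = b'
    · exact irrefl_of (prefA a) b (he ▸ h1)
    · exact asymm_of (prefA a) h1 (best_spec hb' b hmem he)

end

/-! ### Stability with respect to the true utilities -/

instance prefOf_isStrictTotalOrder {K : ℕ} (u : Fin K → ℝ) :
    IsStrictTotalOrder (Fin K) (prefOf u) where
  trichotomous := by
    intro a b hab hba
    unfold prefOf at hab hba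
    push Not at hab hba
    have h : u a = u b := le_antisymm hab.1 hba.1
    exact le_antisymm (hba.2 h.symm) (hab.2 h)
  irrefl a := by simp [prefOf]
  trans := by
    rintro a b c (h1 | ⟨h1, h1'⟩) (h2 | ⟨h2, h2'⟩)
    · exact Or.inl (h2.trans h1)
    · exact Or.inl (h2 ▸ h1)
    · exact Or.inl (h1 ▸ h2)
    · exact Or.inr ⟨h1.trans h2, h1'.trans h2'⟩

section

variable {N K : ℕ} {μ u : Fin N → Fin K → ℝ} {armPref : Fin K → Fin N → Fin N → Prop}

/-- Every strict true preference is also an estimated one, so a pair blocking under `μ` would block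
under `u` as well. -/
theorem isStableMatching_agentDA (ha : ∀ j, IsStrictTotalOrder (Fin N) (armPref j))
    (h : ∀ i j k, μ i j < μ i k → u i j < u i k) :
    IsStableMatching μ armPref (agentDA u armPref) := by
  rintro i j ⟨h1, h2⟩
  refine da_stable (prefA := fun i => prefOf (u i)) (prefB := armPref) i j (fun j' hj' => ?_)
    fun i' hi' => ?_
  · have : (agentDA u armPref).agent i = some j' := hj'
    rw [this] at h1
    exact Or.inl (h _ _ _ h1)
  · have : (agentDA u armPref).arm j = some i' := hi'
    rw [this] at h2
    exact h2

theorem isStableMatching_armDA (ha : ∀ j, IsStrictTotalOrder (Fin N) (armPref j))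
    (h : ∀ i j k, μ i j < μ i k → u i j < u i k) :
    IsStableMatching μ armPref (armDA u armPref) := by
  rintro i j ⟨h1, h2⟩
  refine da_stable (prefA := armPref) (prefB := fun i => prefOf (u i)) j i (fun i' hi' => ?_)
    fun j' hj' => ?_
  · have : (armDA u armPref).arm j = some i' := hi'
    rw [this] at h2
    exact h2
  · have : (armDA u armPref).agent i = some j' := hj'
    rw [this] at h1
    exact Or.inl (h _ _ _ h1)

/-- If there are at least as many arms as agents, a stable matching matches every agent. -/
theorem IsStableMatching.exists_agent_eq_some {m : Matching N K}
    (h : IsStableMatching μ armPref m) (hNK : N ≤ K) (i : Fin N) : ∃ j, m.agent i = some j := by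
  by_contra hne
  have hi : m.agent i = none := Option.eq_none_iff_forall_ne_some.2 fun j hj => hne ⟨j, hj⟩
  -- An unmatched agent would block with any unmatched arm, so all arms are matched; this forces `N
  -- = K`, and then every agent is matched too.
  have harm : ∀ j, ∃ i', m.arm j = some i' := by
    intro j
    by_contra hj
    have hj : m.arm j = none := Option.eq_none_iff_forall_ne_some.2 fun i' hi' => hj ⟨i', hi'⟩
    exact h i j ⟨by rw [hi]; trivial, by rw [hj]; trivial⟩
  choose f hf using harm
  have hinj : Function.Injective f := by
    intro j k hjk
    have h1 := (m.consistent _ _).2 (hf j)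
    have h2 := (m.consistent _ _).2 (hf k)
    rw [hjk, h2] at h1
    exact (Option.some.inj h1).symm
  have hsurj : Function.Surjective f := by
    have : N = K := le_antisymm hNK (by simpa using Fintype.card_le_of_injective f hinj)
    subst this
    exact Finite.surjective_of_injective hinj
  obtain ⟨j, rfl⟩ := hsurj i
  exact hne ⟨j, (m.consistent _ _).2 (hf j)⟩

end

/-! ### Elementary bounds on radius and gap -/

theorem confRadius_nonneg (K : ℕ) (β : ℝ) (n : ℕ) : 0 ≤ confRadius K β n := Real.sqrt_nonneg _

theorem minGap_le {N K : ℕ} {μ : Fin N → Fin K → ℝ} (i : Fin N) {j k : Fin K} (h : j ≠ k) : minGap μ ≤ |μ i j - μ i k| :=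
  ciInf_le (Set.finite_range _).bddBelow
    (⟨(i, j, k), h⟩ : {p : Fin N × Fin K × Fin K // p.2.1 ≠ p.2.2})

/-! ## The sampling schedule -/

section

variable {N K : ℕ} [NeZero K]

theorem card_pullRounds_mul (i : Fin N) (j : Fin K) (n : ℕ) :
    (pullRounds i j (K * n)).card = n := by
  have hone : ∀ m : ℕ, ((Finset.Ico m (m + K)).filter fun s => pulledArm N K i s = j).card = 1 := by
    intro m
    -- Each block of `K` consecutive rounds meets every residue class once. Adding `(K - 1) * i`
    -- stands for subtracting `i` modulo `K`.
    rw [Finset.card_eq_one]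
    have hiff : ∀ s, pulledArm N K i s = j ↔ s ≡ j + (K - 1) * i [MOD K] := by
      intro s
      have h1 : pulledArm N K i s = j ↔ s + i ≡ j [MOD K] := by
        unfold pulledArm
        rw [Fin.ext_iff, Fin.val_ofNat, Nat.ModEq, Nat.mod_eq_of_lt j.2]
      have hK : 1 ≤ K := NeZero.one_le
      have h2 : (j + (K - 1) * i : ℕ) + i ≡ j [MOD K] := by
        have : (j + (K - 1) * i : ℕ) + i = j + K * i := by
          obtain ⟨k, rfl⟩ : ∃ k, K = k + 1 := ⟨K - 1, by omega⟩
          simp only [Nat.add_sub_cancel]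
          ring
        rw [this]
        simp [Nat.ModEq]
      rw [h1]
      exact ⟨fun h => Nat.ModEq.add_right_cancel' i (h.trans h2.symm),
        fun h => (h.add_right i).trans h2⟩
    simp only [hiff]
    rw [← Finset.card_eq_one, Nat.filter_Ico_card_eq_of_periodic _ _ _ (fun s => by simp [Nat.ModEq])]
    rw [Nat.count_modEq_card _ (NeZero.pos K)]
    simp [Nat.div_self (NeZero.pos K)]
  induction n with
  | zero => simp [pullRounds]
  | succ n ih =>
    have : pullRounds i j (K * (n + 1)) = pullRounds i j (K * n) ∪
        (Finset.Ico (K * n) (K * n + K)).filter fun s => pulledArm N K i s = j := by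
      unfold pullRounds
      rw [← Finset.filter_union, mul_add, mul_one]
      congr 1
      ext s
      simp only [Finset.mem_range, Finset.mem_union, Finset.mem_Ico]
      omega
    rw [this, Finset.card_union_of_disjoint, ih, hone]
    rw [Finset.disjoint_left]
    intro s hs hs'
    simp only [pullRounds, Finset.mem_filter, Finset.mem_range, Finset.mem_Ico] at hs hs'
    omega

theorem totalSamples_eq (t : ℕ) : totalSamples N K t = N * t := by
  have : ∀ i : Fin N, ∑ j : Fin K, (pullRounds i j t).card = t := by
    intro i
    have := Finset.card_eq_sum_card_fiberwise (f := fun s => pulledArm N K i s)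
      (s := Finset.range t) (t := Finset.univ) (fun _ _ => by simp)
    rw [Finset.card_range] at this
    exact this.symm
  simp [totalSamples, this]

/-- The sets grow with `t`, so equal size forces equality. This turns a union over rounds into one
over sample counts. -/
theorem pullRounds_eq_of_card_eq {i : Fin N} {j : Fin K} {t t' : ℕ}
    (h : (pullRounds i j t).card = (pullRounds i j t').card) :
    pullRounds i j t = pullRounds i j t' := by
  have hmono : ∀ {a b : ℕ}, a ≤ b → pullRounds i j a ⊆ pullRounds i j b := fun hab =>
    Finset.filter_subset_filter _ (Finset.range_mono hab)
  rcases le_total t t' with hle | hle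
  · exact Finset.eq_of_subset_of_card_le (hmono hle) h.ge
  · exact (Finset.eq_of_subset_of_card_le (hmono hle) h.le).symm

/-! ## The stopping rule on the event that all confidence intervals are valid -/

/-- Every confidence interval contains the mean that it estimates. -/
def ConfidenceValid (β : ℝ) (μ : Fin N → Fin K → ℝ) (x : Fin N → ℕ → ℝ) : Prop :=
  ∀ i (j : Fin K) t, (pullRounds i j t).card ≠ 0 →
    |sampleMean x t i j - μ i j| ≤ confRadius K β (pullRounds i j t).card

variable {β : ℝ} {μ : Fin N → Fin K → ℝ} {x : Fin N → ℕ → ℝ}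

/-- The estimate and the true mean both lie in the interval, so separated intervals order both in
the same way. The infinite bounds of an unsampled pair never separate. -/
theorem lt_of_ucb_lt_lcb (h : ConfidenceValid β μ x) {t : ℕ} {i : Fin N} {j k : Fin K}
    (hlt : ucb β x t i j < lcb β x t i k) :
    sampleMean x t i j < sampleMean x t i k ∧ μ i j < μ i k := by
  unfold ucb lcb at hlt
  split_ifs at hlt with h1 h2 h2
  · simp at hlt
  · simp at hlt
  · simp at hlt
  · rw [EReal.coe_lt_coe_iff] at hlt
    have h3 := abs_le.1 (h i j t h1)
    have h4 := abs_le.1 (h i k t h2)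
    have h5 := confRadius_nonneg K β (pullRounds i j t).card
    have h6 := confRadius_nonneg K β (pullRounds i k t).card
    constructor <;> linarith

/-- A function on `Fin K` that decreases from each index to the next is strictly decreasing. -/
theorem strictAnti_of_forall_succ_lt {f : Fin K → ℝ}
    (h : ∀ (k : ℕ) (hk : k + 1 < K), f ⟨k + 1, hk⟩ < f ⟨k, Nat.lt_of_succ_lt hk⟩) :
    StrictAnti f := by
  obtain ⟨m, rfl⟩ : ∃ m, K = m + 1 := ⟨K - 1, by have := NeZero.pos K; omega⟩
  exact Fin.strictAnti_iff_succ_lt.2 fun k => h k (by omega)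

/-- When the algorithm stops, the estimates order the arms correctly. -/
theorem StopTest.sampleMean_lt {t : ℕ} (h : 2 ≤ K → ConfidenceValid β μ x)
    (hs : StopTest (K := K) β x t) (i : Fin N) (j k : Fin K) (hlt : μ i j < μ i k) :
    sampleMean x t i j < sampleMean x t i k := by
  have hjk : j ≠ k := by rintro rfl; exact lt_irrefl _ hlt
  have hK : 2 ≤ K := by
    have := j.2
    have := k.2
    have := Fin.val_ne_of_ne hjk
    omega
  obtain ⟨σ, hσ⟩ := hs i
  have hm : StrictAnti fun k => sampleMean x t i (σ k) :=
    strictAnti_of_forall_succ_lt fun k hk => (lt_of_ucb_lt_lcb (h hK) (hσ k hk)).1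
  have hμ : StrictAnti fun k => μ i (σ k) :=
    strictAnti_of_forall_succ_lt fun k hk => (lt_of_ucb_lt_lcb (h hK) (hσ k hk)).2
  have h1 := hμ.lt_iff_gt (a := σ.symm j) (b := σ.symm k)
  have h2 := hm.lt_iff_gt (a := σ.symm j) (b := σ.symm k)
  simp only [Equiv.apply_symm_apply] at h1 h2
  have h1' := hμ.lt_iff_gt (a := σ.symm k) (b := σ.symm j)
  have h2' := hm.lt_iff_gt (a := σ.symm k) (b := σ.symm j)
  simp only [Equiv.apply_symm_apply] at h1' h2'
  tauto

theorem minGap_pos [NeZero N] (hK : 2 ≤ K) (hμ : ∀ i, Function.Injective (μ i)) :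
    0 < minGap μ := by
  have : Nonempty {p : Fin N × Fin K × Fin K // p.2.1 ≠ p.2.2} :=
    ⟨⟨(0, ⟨0, by omega⟩, ⟨1, by omega⟩), by simp⟩⟩
  obtain ⟨p, hp⟩ := exists_eq_ciInf_of_finite
    (f := fun p : {p : Fin N × Fin K × Fin K // p.2.1 ≠ p.2.2} =>
      |μ p.1.1 p.1.2.1 - μ p.1.1 p.1.2.2|)
  unfold minGap
  rw [← hp]
  exact abs_pos.2 (sub_ne_zero.2 fun h => p.2 (hμ _ h))

/-- Once the confidence intervals are shorter than half the gap, the algorithm stops. -/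
theorem stopTest_mul (h : 2 ≤ K → ConfidenceValid β μ x)
    {n : ℕ} (hn : n ≠ 0) (hr : 2 ≤ K → 4 * confRadius K β n < minGap μ) :
    StopTest (K := K) β x (K * n) := by
  intro i
  -- The witness sorts the arms by decreasing true mean.
  refine ⟨Tuple.sort fun j => -μ i j, fun k hk => ?_⟩
  have hK : 2 ≤ K := by omega
  set σ := Tuple.sort fun j => -μ i j
  have hne : σ ⟨k, Nat.lt_of_succ_lt hk⟩ ≠ σ ⟨k + 1, hk⟩ := σ.injective.ne (by simp)
  have hle := Tuple.monotone_sort (fun j => -μ i j)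
    (show (⟨k, Nat.lt_of_succ_lt hk⟩ : Fin K) ≤ ⟨k + 1, hk⟩ by simp [Fin.le_def])
  simp only [Function.comp_apply, neg_le_neg_iff] at hle
  have hgap := minGap_le (μ := μ) i hne
  rw [abs_of_nonneg (by linarith)] at hgap
  have hc := h hK i
  unfold ucb lcb
  simp only [card_pullRounds_mul, hn, if_false]
  rw [EReal.coe_lt_coe_iff]
  have h1 := abs_le.1 (hc (σ ⟨k, Nat.lt_of_succ_lt hk⟩) (K * n) (by rwa [card_pullRounds_mul]))
  have h2 := abs_le.1 (hc (σ ⟨k + 1, hk⟩) (K * n) (by rwa [card_pullRounds_mul]))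
  rw [card_pullRounds_mul] at h1 h2
  -- Two estimation errors and two half-widths, each at most one radius, fit into a gap above four
  -- radii.
  linarith [hr hK]

/-- If the stopping test succeeds after some number `t` of rounds within the budget, the algorithm
stops by its stopping rule, after at most `t` rounds. -/
theorem exists_roundsPlayed_eq {T : ℕ∞} {t : ℕ} (ht : 1 ≤ t) (hT : (t : ℕ∞) ≤ T)
    (hs : StopTest (K := K) β x t) :
    ∃ r : ℕ, roundsPlayed (K := K) β T x = r ∧ StopTest (K := K) β x r ∧ r ≤ t := by
  classical
  have hex : ∃ t, 1 ≤ t ∧ StopTest (K := K) β x t := ⟨t, ht, hs⟩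
  have hle : Nat.find hex ≤ t := Nat.find_min' hex ⟨ht, hs⟩
  refine ⟨Nat.find hex, ?_, (Nat.find_spec hex).2, hle⟩
  have hInf : sInf {r : ℕ∞ | ∃ t : ℕ, 1 ≤ t ∧ StopTest (K := K) β x t ∧ r = t} =
      (Nat.find hex : ℕ∞) := by
    refine le_antisymm (sInf_le ⟨_, (Nat.find_spec hex).1, (Nat.find_spec hex).2, rfl⟩)
      (le_sInf ?_)
    rintro _ ⟨s, hs1, hs2, rfl⟩
    exact_mod_cast Nat.find_min' hex ⟨hs1, hs2⟩
  rw [roundsPlayed, hInf]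
  exact min_eq_right ((Nat.cast_le.2 hle).trans hT)

end

/-! ## The confidence intervals are valid with high probability -/

section

variable {N K : ℕ} [NeZero N] [NeZero K]

theorem log_four_mul_div_pos {α : ℝ} (h0 : 0 < α) (h1 : α < 1) :
    0 < Real.log (4 * N / α) := by
  have hN : (1 : ℝ) ≤ N := by exact_mod_cast (NeZero.one_le : 1 ≤ N)
  refine Real.log_pos ?_
  rw [lt_div_iff₀ h0]
  linarith

theorem two_mul_exp_confRadius_le (hK : 2 ≤ K) {α : ℝ} (h0 : 0 < α) (h1 : α < 1) {n : ℕ}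
    (hn : n ≠ 0) :
    2 * Real.exp (-(n * confRadius K (betaParam 32 N K α) n) ^ 2 / (32 * n)) ≤
      α / (2 * N * K ^ 2) * (1 / (n : ℝ) ^ 2) := by
  have hN : (1 : ℝ) ≤ N := by exact_mod_cast (NeZero.one_le : 1 ≤ N)
  have hn' : (1 : ℝ) ≤ n := by exact_mod_cast Nat.one_le_iff_ne_zero.2 hn
  have hK' : (2 : ℝ) ≤ K := by exact_mod_cast hK
  have hL := log_four_mul_div_pos (N := N) h0 h1
  set L := Real.log (4 * N / α) with hLdef
  have hlK : 0 < Real.log K := Real.log_pos (by linarith)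
  have hKn : (K : ℝ) ≤ K * n := by nlinarith
  have hlKn : Real.log K ≤ Real.log (K * n) := Real.log_le_log (by linarith) hKn
  have hβ : 0 ≤ betaParam 32 N K α := by
    unfold betaParam
    positivity
  have hsq : confRadius K (betaParam 32 N K α) n ^ 2 =
      2 * betaParam 32 N K α * Real.log (K * n) / n := by
    unfold confRadius
    refine Real.sq_sqrt ?_
    have : 0 ≤ Real.log (K * n) := by linarith
    positivity
  have hexp : -(n * confRadius K (betaParam 32 N K α) n) ^ 2 / (32 * n) ≤
      -(L + 2 * Real.log (K * n)) := by
    rw [mul_pow, hsq]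
    have h2 : -((n : ℝ) ^ 2 * (2 * betaParam 32 N K α * Real.log (K * n) / n)) / (32 * n) =
        -(2 * Real.log (K * n) + 2 * L * (Real.log (K * n) / Real.log K)) := by
      unfold betaParam
      rw [← hLdef]
      field_simp
    rw [h2]
    -- The quotient by `log K` in `β` is made for this: multiplied by `log(K n) ≥ log K` it still
    -- leaves the full `L = log(4N/α)`.
    have h3 : 1 ≤ Real.log (K * n) / Real.log K := (one_le_div hlK).2 hlKn
    nlinarith
  calc _ ≤ 2 * Real.exp (-(L + 2 * Real.log (K * n))) := by gcongr
    _ = _ := by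
      rw [neg_add, Real.exp_add, Real.exp_neg, hLdef, Real.exp_log (by positivity),
        show -(2 * Real.log ((K : ℝ) * n)) = -Real.log (((K : ℝ) * n) ^ 2) by
          rw [Real.log_pow]; push_cast; ring,
        Real.exp_neg, Real.exp_log (by positivity)]
      field_simp
      norm_num

variable {μ : Fin N → Fin K → ℝ} {ν : Fin N → Fin K → Measure ℝ} {Ω : Type*} [MeasurableSpace Ω]
  {P : Measure Ω} [IsProbabilityMeasure P] {X : Fin N → ℕ → Ω → ℝ}

theorem measure_confRadius_lt_le (hν : ∀ i j, IsRewardLaw (ν i j) (μ i j))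
    (hX : ∀ i s, HasLaw (X i s) (ν i (pulledArm N K i s)) P) (hind : ∀ i, iIndepFun (X i) P)
    (hK : 2 ≤ K) {α : ℝ} (h0 : 0 < α) (h1 : α < 1) (i : Fin N) (j : Fin K) (n : ℕ) :
    P {ω | ∃ t, (pullRounds i j t).card = n ∧ n ≠ 0 ∧ confRadius K (betaParam 32 N K α) n <
      |sampleMean (fun i s => X i s ω) t i j - μ i j|} ≤
      ENNReal.ofReal (α / (2 * N * K ^ 2) * (1 / (n : ℝ) ^ 2)) := by
  by_cases hex : n ≠ 0 ∧ ∃ t, (pullRounds i j t).card = n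
  · obtain ⟨hn, t, ht⟩ := hex
    set F := pullRounds i j t with hF
    have hn' : (0 : ℝ) < n := by exact_mod_cast Nat.pos_of_ne_zero hn
    have hsub : {ω | ∃ t, (pullRounds i j t).card = n ∧ n ≠ 0 ∧
        confRadius K (betaParam 32 N K α) n <
          |sampleMean (fun i s => X i s ω) t i j - μ i j|} ⊆
        {ω | n * confRadius K (betaParam 32 N K α) n <
          |∑ s ∈ F, (X i s ω - μ i (pulledArm N K i s))|} := by
      rintro ω ⟨t', ht', -, hlt⟩
      rw [Set.mem_ofPred_eq]
      have hFt : pullRounds i j t' = F := pullRounds_eq_of_card_eq (ht'.trans ht.symm)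
      have hsum : ∑ s ∈ F, (X i s ω - μ i (pulledArm N K i s)) =
          n * (sampleMean (fun i s => X i s ω) t' i j - μ i j) := by
        have : ∑ s ∈ F, μ i (pulledArm N K i s) = n * μ i j := by
          rw [← ht, ← nsmul_eq_mul]
          refine Finset.sum_eq_card_nsmul fun s hs => ?_
          rw [(Finset.mem_filter.1 hs).2]
        rw [Finset.sum_sub_distrib, this, sampleMean, hFt, ht]
        field_simp
      rw [hsum, abs_mul, abs_of_pos hn']
      exact mul_lt_mul_of_pos_left hlt hn'
    have hb := measureReal_lt_abs_sum_le (P := P) (X := X i) (fun s => hν i (pulledArm N K i s))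
      (hX i) (hind i) F (ε := n * confRadius K (betaParam 32 N K α) n)
      (mul_nonneg hn'.le (confRadius_nonneg _ _ _))
    rw [ht] at hb
    refine (measure_mono hsub).trans ?_
    rw [← ofReal_measureReal]
    exact ENNReal.ofReal_le_ofReal (hb.trans (two_mul_exp_confRadius_le hK h0 h1 hn))
  · rw [show {ω | ∃ t, (pullRounds i j t).card = n ∧ n ≠ 0 ∧ confRadius K (betaParam 32 N K α) n <
      |sampleMean (fun i s => X i s ω) t i j - μ i j|} = ∅ from
      Set.eq_empty_of_forall_notMem fun ω ⟨t, ht, hn, _⟩ => hex ⟨hn, t, ht⟩]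
    simp

theorem measure_not_confidenceValid_le (hν : ∀ i j, IsRewardLaw (ν i j) (μ i j))
    (hX : ∀ i s, HasLaw (X i s) (ν i (pulledArm N K i s)) P) (hind : ∀ i, iIndepFun (X i) P)
    (hK : 2 ≤ K) {α : ℝ} (h0 : 0 < α) (h1 : α < 1) :
    P {ω | ¬ ConfidenceValid (betaParam 32 N K α) μ fun i s => X i s ω} ≤
      ENNReal.ofReal α := by
  have hN : (0 : ℝ) < N := by exact_mod_cast NeZero.pos N
  have hK' : (2 : ℝ) ≤ K := by exact_mod_cast hK
  set B : Fin N → Fin K → ℕ → Set Ω := fun i j n =>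
    {ω | ∃ t, (pullRounds i j t).card = n ∧ n ≠ 0 ∧ confRadius K (betaParam 32 N K α) n <
      |sampleMean (fun i s => X i s ω) t i j - μ i j|} with hB
  have hsub : {ω | ¬ ConfidenceValid (betaParam 32 N K α) μ fun i s => X i s ω} ⊆
      ⋃ i, ⋃ j, ⋃ n, B i j n := by
    intro ω hω
    simp only [Set.mem_ofPred_eq, ConfidenceValid, not_forall, not_le] at hω
    obtain ⟨i, j, t, hn, hlt⟩ := hω
    simp only [Set.mem_iUnion]
    exact ⟨i, j, _, t, rfl, hn, hlt⟩
  have hn : ∀ i j, P (⋃ n, B i j n) ≤ ENNReal.ofReal (α / (N * K)) := by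
    intro i j
    have hs := hasSum_zeta_two.mul_left (α / (2 * N * K ^ 2))
    calc P (⋃ n, B i j n) ≤ ∑' n, P (B i j n) := measure_iUnion_le _
      _ ≤ ∑' n : ℕ, ENNReal.ofReal (α / (2 * N * K ^ 2) * (1 / (n : ℝ) ^ 2)) :=
        ENNReal.tsum_le_tsum fun n => measure_confRadius_lt_le hν hX hind hK h0 h1 i j n
      _ = ENNReal.ofReal (α / (2 * N * K ^ 2) * (Real.pi ^ 2 / 6)) := by
        rw [← ENNReal.ofReal_tsum_of_nonneg (fun n => by positivity) hs.summable, hs.tsum_eq]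
      _ ≤ _ := by
        refine ENNReal.ofReal_le_ofReal ?_
        -- Crude, but `K ≥ 2` leaves ample room; the factor `2 K` cancels part of `2 N K²`.
        have hpi : Real.pi ^ 2 / 6 ≤ 2 * K := by
          nlinarith [Real.pi_lt_d2, Real.pi_pos]
        calc _ ≤ α / (2 * N * K ^ 2) * (2 * K) := by gcongr
          _ = _ := by field_simp
  calc _ ≤ P (⋃ i, ⋃ j, ⋃ n, B i j n) := measure_mono hsub
    _ ≤ ∑ i, P (⋃ j, ⋃ n, B i j n) := measure_iUnion_fintype_le _ _
    _ ≤ ∑ i : Fin N, ∑ j : Fin K, ENNReal.ofReal (α / (N * K)) :=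
      Finset.sum_le_sum fun i _ => (measure_iUnion_fintype_le _ _).trans
        (Finset.sum_le_sum fun j _ => hn i j)
    _ = _ := by
      simp only [Finset.sum_const, Finset.card_univ, Fintype.card_fin, nsmul_eq_mul]
      rw [← ENNReal.ofReal_natCast, ← ENNReal.ofReal_natCast, ← ENNReal.ofReal_mul (by positivity),
        ← ENNReal.ofReal_mul (by positivity)]
      congr 1
      field_simp

end

/-! ## The number of samples -/

/-- The rate `g = N K max(1, 1/Δ²) max(1, log (1/α))`. -/
def sampleRate (N K : ℕ) (Δ α : ℝ) : ℝ :=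
  (N : ℝ) * (K : ℝ) * max 1 (1 / Δ ^ 2) * max 1 (Real.log (1 / α))

/-- A number of samples per pair that suffices for the algorithm to stop. -/
def samplesPerPair (N K : ℕ) (Δ α : ℝ) : ℕ :=
  ⌈2 ^ 20 * (max 1 (1 / Δ ^ 2) * max 1 (Real.log (1 / α)) *
    Real.log (2 + sampleRate N K Δ α) ^ 2)⌉₊

theorem mul_le_sampleRate {N K : ℕ} (Δ α : ℝ) : (N : ℝ) * K ≤ sampleRate N K Δ α := by
  unfold sampleRate
  rw [mul_assoc ((N : ℝ) * K)]
  exact le_mul_of_one_le_right (by positivity)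
    (one_le_mul_of_one_le_of_one_le (le_max_left _ _) (le_max_left _ _))

section

variable {N K : ℕ} [NeZero N] [NeZero K]

theorem max_mul_max_le_sampleRate (Δ α : ℝ) :
    max 1 (1 / Δ ^ 2) * max 1 (Real.log (1 / α)) ≤ sampleRate N K Δ α := by
  have hN : (1 : ℝ) ≤ N := by exact_mod_cast (NeZero.one_le : 1 ≤ N)
  have hK : (1 : ℝ) ≤ K := by exact_mod_cast (NeZero.one_le : 1 ≤ K)
  have hNK : (1 : ℝ) ≤ N * K := one_le_mul_of_one_le_of_one_le hN hK
  unfold sampleRate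
  rw [mul_assoc ((N : ℝ) * K)]
  exact le_mul_of_one_le_left (by positivity) hNK

theorem one_le_sampleRate (Δ α : ℝ) : 1 ≤ sampleRate N K Δ α :=
  (one_le_mul_of_one_le_of_one_le (le_max_left _ _) (le_max_left _ _)).trans
    (max_mul_max_le_sampleRate Δ α)

theorem one_le_log_two_add {g : ℝ} (hg : 1 ≤ g) : 1 ≤ Real.log (2 + g) := by
  rw [Real.le_log_iff_exp_le (by linarith)]
  linarith [Real.exp_one_lt_d9]

theorem samplesPerPair_le (Δ α : ℝ) :
    (samplesPerPair N K Δ α : ℝ) ≤ 2 ^ 21 * (max 1 (1 / Δ ^ 2) * max 1 (Real.log (1 / α)) *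
      Real.log (2 + sampleRate N K Δ α) ^ 2) := by
  have hl := one_le_log_two_add (one_le_sampleRate (N := N) (K := K) Δ α)
  have h1 : 1 ≤ max 1 (1 / Δ ^ 2) * max 1 (Real.log (1 / α)) *
      Real.log (2 + sampleRate N K Δ α) ^ 2 :=
    one_le_mul_of_one_le_of_one_le
      (one_le_mul_of_one_le_of_one_le (le_max_left _ _) (le_max_left _ _)) (one_le_pow₀ hl)
  have h2 := Nat.ceil_lt_add_one (a := 2 ^ 20 * (max 1 (1 / Δ ^ 2) * max 1 (Real.log (1 / α)) *
      Real.log (2 + sampleRate N K Δ α) ^ 2)) (by positivity)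
  unfold samplesPerPair
  linarith

theorem samplesPerPair_ne_zero (Δ α : ℝ) : samplesPerPair N K Δ α ≠ 0 := by
  have hl := one_le_log_two_add (one_le_sampleRate (N := N) (K := K) Δ α)
  exact (Nat.ceil_pos.2 (by positivity)).ne'

/-- The radius contains the logarithm of the sample count itself. As that count is polynomial in `2
+ g`, the logarithm is only a multiple of `log(2 + g)`. -/
theorem log_mul_samplesPerPair_le (Δ α : ℝ) :
    Real.log (K * samplesPerPair N K Δ α) ≤ 24 * Real.log (2 + sampleRate N K Δ α) := by
  have hg := one_le_sampleRate (N := N) (K := K) Δ α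
  have hl := one_le_log_two_add hg
  have hn := samplesPerPair_le (N := N) (K := K) Δ α
  have hn0 : (0 : ℝ) < samplesPerPair N K Δ α := by
    exact_mod_cast Nat.pos_of_ne_zero (samplesPerPair_ne_zero Δ α)
  have hN : (1 : ℝ) ≤ N := by exact_mod_cast (NeZero.one_le : 1 ≤ N)
  have hK : (0 : ℝ) < K := by exact_mod_cast NeZero.pos K
  set ℓ := Real.log (2 + sampleRate N K Δ α) with hℓ
  have hKg : K * (max 1 (1 / Δ ^ 2) * max 1 (Real.log (1 / α))) ≤ sampleRate N K Δ α := by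
    unfold sampleRate
    rw [mul_assoc ((N : ℝ) * K), mul_assoc]
    exact le_mul_of_one_le_left (by positivity) hN
  set g := sampleRate N K Δ α
  have hℓg : ℓ ≤ 2 + g := (Real.log_le_sub_one_of_pos (by linarith)).trans (by linarith)
  have h1 : K * (samplesPerPair N K Δ α : ℝ) ≤ 2 ^ 21 * (2 + g) ^ 3 :=
    calc K * (samplesPerPair N K Δ α : ℝ)
        ≤ K * (2 ^ 21 * (max 1 (1 / Δ ^ 2) * max 1 (Real.log (1 / α)) * ℓ ^ 2)) := by gcongr
      _ = 2 ^ 21 * (K * (max 1 (1 / Δ ^ 2) * max 1 (Real.log (1 / α))) * ℓ ^ 2) := by ring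
      _ ≤ 2 ^ 21 * ((2 + g) * (2 + g) ^ 2) := by
        gcongr
        linarith
      _ = _ := by ring
  calc _ ≤ Real.log (2 ^ 21 * (2 + g) ^ 3) := Real.log_le_log (by positivity) h1
    _ = 21 * Real.log 2 + 3 * ℓ := by
      rw [Real.log_mul (by positivity) (by positivity), Real.log_pow, Real.log_pow]
      norm_num [hℓ]
    _ ≤ _ := by linarith [Real.log_two_lt_d9]

theorem betaParam_le (hK : 2 ≤ K) (Δ : ℝ) {α : ℝ} (h0 : 0 < α) :
    betaParam 32 N K α ≤
      288 * (max 1 (Real.log (1 / α)) * Real.log (2 + sampleRate N K Δ α)) := by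
  have hg := one_le_sampleRate (N := N) (K := K) Δ α
  have hl := one_le_log_two_add hg
  have hN : (1 : ℝ) ≤ N := by exact_mod_cast (NeZero.one_le : 1 ≤ N)
  have hK' : (2 : ℝ) ≤ K := by exact_mod_cast hK
  have hNg : (N : ℝ) ≤ 2 + sampleRate N K Δ α := by
    have := mul_le_sampleRate (N := N) (K := K) Δ α
    nlinarith
  set ℓ := Real.log (2 + sampleRate N K Δ α)
  set A := max 1 (Real.log (1 / α)) with hA
  have hA1 : 1 ≤ A := le_max_left _ _
  have hA2 : Real.log (1 / α) ≤ A := le_max_right _ _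
  have hlogN : Real.log N ≤ ℓ := Real.log_le_log (by linarith) hNg
  have hlogK : 1 / 2 ≤ Real.log K :=
    (by linarith [Real.log_two_gt_d9] : (1 : ℝ) / 2 ≤ Real.log 2).trans
      (Real.log_le_log (by norm_num) hK')
  have hL : Real.log (4 * N / α) ≤ 4 * (A * ℓ) := by
    rw [show 4 * (N : ℝ) / α = 2 ^ 2 * N * (1 / α) by ring,
      Real.log_mul (by positivity) (by positivity), Real.log_mul (by positivity) (by positivity),
      Real.log_pow]
    have := Real.log_two_lt_d9
    push_cast
    nlinarith
  have hq : Real.log (4 * N / α) / Real.log K ≤ 8 * (A * ℓ) := by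
    rw [div_le_iff₀ (by linarith)]
    have : 0 ≤ A * ℓ := by positivity
    nlinarith
  unfold betaParam
  nlinarith

theorem four_mul_confRadius_samplesPerPair_lt (hK : 2 ≤ K) {Δ α : ℝ} (hΔ : 0 < Δ) (h0 : 0 < α) :
    4 * confRadius K (betaParam 32 N K α) (samplesPerPair N K Δ α) < Δ := by
  have hg := one_le_sampleRate (N := N) (K := K) Δ α
  have hl := one_le_log_two_add hg
  have hβ := betaParam_le (N := N) hK Δ h0
  have hlog := log_mul_samplesPerPair_le (N := N) (K := K) Δ α
  have hn0 := samplesPerPair_ne_zero (N := N) (K := K) Δ α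
  have hn : 2 ^ 20 * (max 1 (1 / Δ ^ 2) * max 1 (Real.log (1 / α)) *
      Real.log (2 + sampleRate N K Δ α) ^ 2) ≤ samplesPerPair N K Δ α := Nat.le_ceil _
  set n := samplesPerPair N K Δ α
  set ℓ := Real.log (2 + sampleRate N K Δ α)
  set A := max 1 (Real.log (1 / α))
  have hA1 : 1 ≤ A := le_max_left _ _
  have hM : 1 ≤ max 1 (1 / Δ ^ 2) * Δ ^ 2 := by
    rw [← div_le_iff₀ (by positivity)]
    exact le_max_right _ _
  have hn1 : (1 : ℝ) ≤ n := by exact_mod_cast Nat.one_le_iff_ne_zero.2 hn0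
  have hK' : (2 : ℝ) ≤ K := by exact_mod_cast hK
  have hlog0 : 0 ≤ Real.log (K * n) := Real.log_nonneg (by nlinarith)
  have hprod : betaParam 32 N K α * Real.log (K * n) ≤ 6912 * (A * ℓ ^ 2) :=
    calc _ ≤ 288 * (A * ℓ) * (24 * ℓ) := by gcongr
      _ = _ := by ring
  have hnΔ : 2 ^ 20 * (A * ℓ ^ 2) ≤ n * Δ ^ 2 :=
    calc 2 ^ 20 * (A * ℓ ^ 2) ≤ 2 ^ 20 * (A * ℓ ^ 2) * (max 1 (1 / Δ ^ 2) * Δ ^ 2) :=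
          le_mul_of_one_le_right (by positivity) hM
      _ = 2 ^ 20 * (max 1 (1 / Δ ^ 2) * A * ℓ ^ 2) * Δ ^ 2 := by ring
      _ ≤ _ := by gcongr
  have hpos : 0 < A * ℓ ^ 2 := by positivity
  -- Squared, the claim reads `32 β log(K n) < n Δ²`, and `32 * 6912 < 2 ^ 20`.
  rw [← lt_div_iff₀' (by norm_num : (0 : ℝ) < 4), confRadius, Real.sqrt_lt' (by positivity),
    div_lt_iff₀ (by linarith)]
  nlinarith

end

theorem isSoftO_mul_samplesPerPair :
    IsSoftO
      (fun q : ℕ × ℕ × ℝ × ℝ =>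
        ((q.1 * (q.2.1 * samplesPerPair q.1 q.2.1 q.2.2.1 q.2.2.2) : ℕ) : ℝ))
      (fun q : ℕ × ℕ × ℝ × ℝ => sampleRate q.1 q.2.1 q.2.2.1 q.2.2.2) := by
  refine ⟨2 ^ 21, by norm_num, 2, ?_⟩
  rintro ⟨N, K, Δ, α⟩
  dsimp only
  -- The rate bound ranges over all parameters; for `N = 0` or `K = 0` both sides vanish.
  rcases Nat.eq_zero_or_pos N with rfl | hN
  · simp [sampleRate]
  rcases Nat.eq_zero_or_pos K with rfl | hK
  · simp [sampleRate]
  have : NeZero N := ⟨hN.ne'⟩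
  have : NeZero K := ⟨hK.ne'⟩
  push_cast
  calc (N : ℝ) * (K * samplesPerPair N K Δ α)
      ≤ N * (K * (2 ^ 21 * (max 1 (1 / Δ ^ 2) * max 1 (Real.log (1 / α)) *
          Real.log (2 + sampleRate N K Δ α) ^ 2))) := by
        gcongr
        exact samplesPerPair_le Δ α
    _ = 2 ^ 21 * (N * K * max 1 (1 / Δ ^ 2) * max 1 (Real.log (1 / α))) *
          Real.log (2 + sampleRate N K Δ α) ^ 2 := by ring
    _ = _ := rfl

end

/-! ### Proof of the main theorem -/

theorem mainTheorem3 :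
    ∃ c : ℝ, 0 < c ∧ ∃ S : ℕ → ℕ → ℝ → ℝ → ℕ,
      IsSoftO
        (fun q : ℕ × ℕ × ℝ × ℝ => (S q.1 q.2.1 q.2.2.1 q.2.2.2 : ℝ))
        (fun q : ℕ × ℕ × ℝ × ℝ =>
          (q.1 : ℝ) * (q.2.1 : ℝ) * max 1 (1 / q.2.2.1 ^ 2) * max 1 (Real.log (1 / q.2.2.2))) ∧
      ∀ (N K : ℕ) [NeZero N] [NeZero K]
        (μ : Fin N → Fin K → ℝ) (_ : ∀ i, Function.Injective (μ i))
        (armPref : Fin K → Fin N → Fin N → Prop)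
        (_ : ∀ j, IsStrictTotalOrder (Fin N) (armPref j))
        (ν : Fin N → Fin K → Measure ℝ) (_ : ∀ i j, IsRewardLaw (ν i j) (μ i j))
        (Ω : Type*) [MeasurableSpace Ω] (P : Measure Ω) [IsProbabilityMeasure P]
        (X : Fin N → ℕ → Ω → ℝ)
        (_ : ∀ i s, HasLaw (X i s) (ν i (pulledArm N K i s)) P)
        (_ : ∀ i, iIndepFun (X i) P)
        (α : ℝ) (_ : 0 < α) (_ : α < 1)
        (T : ℕ∞) (_ : (S N K (minGap μ) α : ℕ∞) ≤ N * T),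
        ENNReal.ofReal (1 - α) ≤
          P {ω | ∃ r : ℕ,
            roundsPlayed (K := K) (betaParam c N K α) T (fun i s => X i s ω) = r ∧
            StopTest (K := K) (betaParam c N K α) (fun i s => X i s ω) r ∧
            totalSamples N K r ≤ S N K (minGap μ) α ∧
            ∀ m ∈ [agentDA (sampleMean (fun i s => X i s ω) r) armPref,
                armDA (sampleMean (fun i s => X i s ω) r) armPref],
              IsStableMatching μ armPref m ∧ (N ≤ K → ∀ i, ∃ j, m.agent i = some j)} := by
  refine ⟨32, by norm_num, fun N K Δ α => N * (K * samplesPerPair N K Δ α),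
    isSoftO_mul_samplesPerPair, ?_⟩
  intro N K _ _ μ hμ armPref hpref ν hν Ω _ P _ X hX hind α h0 h1 T hT
  set n := samplesPerPair N K (minGap μ) α with hn
  have hn0 : n ≠ 0 := samplesPerPair_ne_zero _ _
  have hKT : ((K * n : ℕ) : ℕ∞) ≤ T := by
    cases T with
    | top => exact le_top
    | coe T =>
      have : N * (K * n) ≤ N * T := by exact_mod_cast hT
      exact_mod_cast Nat.le_of_mul_le_mul_left this (NeZero.pos N)
  -- For `K = 1` the test is vacuous and the intervals may fail, as the radius is `0` after one
  -- sample; validity is therefore required only for `K ≥ 2`.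
  set bad : Set Ω := {ω | ¬ (2 ≤ K →
    ConfidenceValid (betaParam 32 N K α) μ fun i s => X i s ω)} with hbad
  have hbad_le : P bad ≤ ENNReal.ofReal α := by
    by_cases hK : 2 ≤ K
    · simp only [hbad, hK, true_imp_iff]
      exact measure_not_confidenceValid_le hν hX hind hK h0 h1
    · simp [hbad, hK]
  -- Subadditivity on `bad` and its complement gives the lower bound without measurability of `bad`.
  have hgood : ENNReal.ofReal (1 - α) ≤ P badᶜ := by
    rw [ENNReal.ofReal_sub _ h0.le, ENNReal.ofReal_one, tsub_le_iff_right,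
      ← measure_univ (μ := P), ← Set.compl_union_self bad]
    exact (measure_union_le _ _).trans (by gcongr)
  refine hgood.trans (measure_mono fun ω hω => ?_)
  have hvalid : 2 ≤ K → ConfidenceValid (betaParam 32 N K α) μ fun i s => X i s ω :=
    not_not.1 hω
  have htest := stopTest_mul hvalid hn0 fun hK =>
    four_mul_confRadius_samplesPerPair_lt hK (minGap_pos hK hμ) h0
  obtain ⟨r, hr, hr1, hr2⟩ := exists_roundsPlayed_eq
    (Nat.one_le_iff_ne_zero.2 (mul_ne_zero (NeZero.ne K) hn0)) hKT htest
  have hord := hr1.sampleMean_lt hvalid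
  refine ⟨r, hr, hr1, ?_, ?_⟩
  · rw [totalSamples_eq]
    exact Nat.mul_le_mul_left N hr2
  · intro m hm
    have hstable : IsStableMatching μ armPref m := by
      simp only [List.mem_cons, List.not_mem_nil, or_false] at hm
      rcases hm with rfl | rfl
      · exact isStableMatching_agentDA hpref hord
      · exact isStableMatching_armDA hpref hord
    exact ⟨hstable, fun hNK => hstable.exists_agent_eq_some hNK⟩
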